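/- For a finite set $D$, let $\mathrm{Sym}(D)$ be the group of all permutations of $D$ and $\mathrm{Alt}(D)$ its subgroup of even permutations. A fixed set for a subgroup $G$ of $\mathrm{Sym}(D)$ is a subset $\Delta \subseteq D$ such that every $g \in G$ maps $\Delta$ to $\Delta$; then $G^{\Delta}$ denotes the subgroup of $\mathrm{Sym}(\Delta)$ consisting of the restrictions $g|_{\Delta}$, $g \in G$. Let $k$ be a natural number. There is a natural number $N \ge k$, depending only on $k$, such that for every finite set $D$ with $|D| = n \ge N$ and every subgroup $G$ of $\mathrm{Sym}(D)$ with $|G| \ge (n-k)!$, there is a fixed set $\Delta$ for $G$ with $|\Delta| \ge n-k$ such that $G^{\Delta}$ contains $\mathrm{Alt}(\Delta)$. -/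

import Mathlib

/-!
Lying on a common 3-cycle of `G` is a `G`-invariant equivalence relation on `D`, and `G` contains
every 3-cycle supported in a class, so it induces at least the alternating group on each class.
It remains to find an invariant class with at least `n - k` points, using that
`|G| ≥ (n - k)!` forces `G` to have index at most `n ^ k` in `Sym(D)`.

If every class has at most `k + 1` points, then a transversal `T` has at least `n / (k + 1)` points
and `G` has no 3-cycle supported in `T`. The commutator of two permutations whose supports meet in
one point is a 3-cycle, so by Bochert's argument some `W ⊆ T` with `2 |W| ≥ |T|` supports no
nontrivial element of `G`. Hence the index of `G` is at least `|W|!`, which exceeds `n ^ k` for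
large `n`. So there is a class `C` with at least `k + 2` points. Elements of `G` that fix a given
point of `C` preserve `C`, so the index of `G` is at least `(n - 1).choose (|C| - 1)`. This exceeds
`n ^ k` unless `|C| ≥ n - k`. Finally a class with more than half of the points meets all its
images, and is therefore fixed.
-/

/-- `Δ` is a fixed set for the permutation group `G`: every `g ∈ G` maps `Δ` to `Δ`. -/
def IsFixedSet {D : Type*} (G : Subgroup (Equiv.Perm D)) (Δ : Finset D) : Prop :=
  ∀ g ∈ G, ∀ x ∈ Δ, g x ∈ Δ

/-- The group `G^Δ` of permutations of `Δ` that are restrictions to `Δ` of elements of `G`.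
For a fixed set `Δ` of `G`, every element of `G` restricts to `Δ`, so that this is the image
of `G` in `Sym(Δ)`. -/
def inducedGroup {D : Type*} (G : Subgroup (Equiv.Perm D)) (Δ : Finset D) :
    Subgroup (Equiv.Perm Δ) where
  carrier := {σ | ∃ g ∈ G, ∀ x : Δ, ((σ x : Δ) : D) = g x}
  one_mem' := ⟨1, G.one_mem, fun _ => rfl⟩
  mul_mem' := by
    rintro σ τ ⟨g, hg, hσ⟩ ⟨h, hh, hτ⟩
    refine ⟨g * h, G.mul_mem hg hh, fun x => ?_⟩
    rw [Equiv.Perm.mul_apply, Equiv.Perm.mul_apply, hσ, hτ]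
  inv_mem' := by
    rintro σ ⟨g, hg, hσ⟩
    refine ⟨g⁻¹, G.inv_mem hg, fun x => ?_⟩
    rw [Equiv.Perm.eq_inv_iff_eq, ← hσ]
    exact congrArg Subtype.val (σ.apply_symm_apply x)

open Equiv Equiv.Perm Filter Asymptotics
open scoped Finset Nat

section ThreeCycles

variable {D : Type*} [DecidableEq D] {G : Subgroup (Perm D)} {a b c : D}

/-- The points `a`, `b`, `c` are distinct and the 3-cycle `a ↦ b ↦ c ↦ a` belongs to `G`. -/
def HasThreeCycle (G : Subgroup (Perm D)) (a b c : D) : Prop :=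
  a ≠ b ∧ b ≠ c ∧ a ≠ c ∧ swap a b * swap b c ∈ G

namespace HasThreeCycle

theorem reverse (h : HasThreeCycle G a b c) : HasThreeCycle G c b a := by
  obtain ⟨hab, hbc, hac, hG⟩ := h
  refine ⟨hbc.symm, hab.symm, hac.symm, ?_⟩
  simpa [swap_comm] using G.inv_mem hG

theorem rotate (h : HasThreeCycle G a b c) : HasThreeCycle G b c a := by
  obtain ⟨hab, hbc, hac, hG⟩ := h
  refine ⟨hbc, hac.symm, hab.symm, ?_⟩
  have : swap b c * swap c a = swap a b * swap b c := by
    ext x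
    simp only [Perm.mul_apply, swap_apply_def]
    grind
  rwa [this]

theorem conj (h : HasThreeCycle G a b c) {g : Perm D} (hg : g ∈ G) :
    HasThreeCycle G (g a) (g b) (g c) := by
  obtain ⟨hab, hbc, hac, hG⟩ := h
  refine ⟨g.injective.ne hab, g.injective.ne hbc, g.injective.ne hac, ?_⟩
  simpa [swap_apply_apply, mul_assoc] using G.mul_mem (G.mul_mem hg hG) (G.inv_mem hg)

theorem exists_mem_apply_eq (h : HasThreeCycle G a b c) :
    ∃ g ∈ G, g a = b ∧ g b = c ∧ g c = a ∧ ∀ x, x ≠ a → x ≠ b → x ≠ c → g x = x := by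
  obtain ⟨hab, hbc, hac, hG⟩ := h
  refine ⟨_, hG, ?_, ?_, ?_, fun x hxa hxb hxc => ?_⟩ <;> grind [Perm.mul_apply]

theorem of_common_edge {d : D} (hb : HasThreeCycle G a b d) (hc : HasThreeCycle G a c d)
    (hbc : b ≠ c) : HasThreeCycle G a b c := by
  -- Conjugating `(a b d)` by `(a c d)` gives `(c b a)`.
  obtain ⟨g, hg, hga, -, hgd, hgx⟩ := hc.exists_mem_apply_eq
  have hgb : g b = b := hgx b hb.1.symm hbc hb.2.1
  have := hb.conj hg
  rw [hga, hgb, hgd] at this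
  exact this.reverse

end HasThreeCycle

/-- The equivalence relation of lying on a common 3-cycle of `G`; a point that lies on no 3-cycle
of `G` is equivalent to itself only. -/
def threeCycleSetoid (G : Subgroup (Perm D)) : Setoid D where
  r x y := x = y ∨ ∃ z, HasThreeCycle G x y z
  iseqv.refl _ := Or.inl rfl
  iseqv.symm := by
    rintro x y (rfl | ⟨z, h⟩)
    exacts [Or.inl rfl, Or.inr ⟨z, h.reverse.rotate⟩]
  iseqv.trans := by
    rintro x y w (rfl | ⟨z, h⟩) (rfl | ⟨v, h'⟩)
    · exact Or.inl rfl
    · exact Or.inr ⟨v, h'⟩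
    · exact Or.inr ⟨z, h⟩
    by_cases hxw : x = w
    · exact Or.inl hxw
    right
    by_cases hxv : x = v
    · subst hxv
      exact ⟨y, h'.reverse⟩
    · -- Conjugate `(x y z)` by `(y w v)`, which fixes `x`.
      obtain ⟨g, hg, hgy, -, -, hgx⟩ := h'.exists_mem_apply_eq
      have := h.conj hg
      rw [hgx x h.1 hxw hxv, hgy] at this
      exact ⟨g z, this⟩

theorem threeCycleSetoid_map {x y : D} (h : threeCycleSetoid G x y) {g : Perm D} (hg : g ∈ G) :
    threeCycleSetoid G (g x) (g y) := by
  rcases h with rfl | ⟨z, h⟩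
  exacts [Or.inl rfl, Or.inr ⟨g z, h.conj hg⟩]

theorem hasThreeCycle_of_threeCycleSetoid (hab : threeCycleSetoid G a b)
    (hbc : threeCycleSetoid G b c) (ne_ab : a ≠ b) (ne_bc : b ≠ c) (ne_ac : a ≠ c) :
    HasThreeCycle G a b c := by
  obtain ⟨z, hz⟩ : ∃ z, HasThreeCycle G a b z := hab.resolve_left ne_ab
  obtain ⟨w, hw⟩ : ∃ w, HasThreeCycle G b c w := hbc.resolve_left ne_bc
  by_cases hzc : z = c
  · rwa [← hzc]
  by_cases hwa : w = a
  · rw [hwa] at hw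
    exact hw.rotate.rotate
  -- Conjugate `(a b z)` by `(b c w)`, which fixes `a`.
  obtain ⟨g, hg, hgb, -, hgw, hgx⟩ := hw.exists_mem_apply_eq
  have hconj := hz.conj hg
  rw [hgx a ne_ab ne_ac (Ne.symm hwa), hgb] at hconj
  by_cases hzw : z = w
  · rw [hzw, hgw] at hconj
    exact hconj.reverse.rotate.rotate
  · rw [hgx z hz.2.1.symm hzc hzw] at hconj
    exact hz.of_common_edge hconj ne_bc

theorem hasThreeCycle_of_support_inter {x y : Perm D} (hx : x ∈ G) (hy : y ∈ G)
    (hxa : x a ≠ a) (hya : y a ≠ a) (h : ∀ d ≠ a, x d = d ∨ y d = d) :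
    HasThreeCycle G a (x a) (y a) := by
  have hyx : y (x a) = x a := (h _ hxa).resolve_left fun e => hxa (x.injective e)
  have hne : x a ≠ y a := fun e => hya (y.injective (e ▸ hyx))
  -- On the support of `y`, the permutation `x` agrees with `swap a (x a)`.
  have hdisj : Perm.Disjoint (x⁻¹ * swap a (x a)) y := by
    intro d
    by_cases hyd : y d = d
    · exact Or.inr hyd
    left
    rw [Perm.mul_apply, Perm.inv_eq_iff_eq]
    by_cases hda : d = a
    · rw [hda, swap_apply_left]
    · rw [swap_apply_of_ne_of_ne hda (fun e => hyd (e ▸ hyx)), (h d hda).resolve_right hyd]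
  have hcomm : swap a (x a) * swap (x a) (y a) = x * y * x⁻¹ * y⁻¹ := by
    calc swap a (x a) * swap (x a) (y a)
        = swap a (x a) * (y * swap a (x a) * y⁻¹) := by
          rw [← swap_apply_apply, hyx, swap_comm (x a)]
      _ = x * ((x⁻¹ * swap a (x a)) * y) * (swap a (x a))⁻¹ * y⁻¹ := by
          rw [swap_inv]; group
      _ = x * y * x⁻¹ * y⁻¹ := by rw [hdisj.commute.eq]; group
  refine ⟨hxa.symm, hne, hya.symm, ?_⟩
  rw [hcomm]
  exact G.mul_mem (G.mul_mem (G.mul_mem hx hy) (G.inv_mem hx)) (G.inv_mem hy)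

end ThreeCycles

theorem alternatingGroup_le_inducedGroup {D : Type*} [DecidableEq D] {G : Subgroup (Perm D)}
    {C : Finset D} (hC : ∀ a ∈ C, ∀ b ∈ C, threeCycleSetoid G a b) :
    alternatingGroup C ≤ inducedGroup G C := by
  rw [← closure_three_cycles_eq_alternating, Subgroup.closure_le]
  intro σ (hσ : σ.IsThreeCycle)
  obtain ⟨a, ha⟩ : σ.support.Nonempty := by simp [← Finset.card_pos, hσ.card_support]
  have hnodup : [a, σ a, σ (σ a)].Nodup := hσ.nodup_iff_mem_support.2 ha
  have hσ_eq : σ = swap a (σ a) * swap (σ a) (σ (σ a)) :=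
    hσ.eq_swap_mul_swap_iff_mem_support.2 ha
  obtain ⟨hab, hac, hbc⟩ : a ≠ σ a ∧ a ≠ σ (σ a) ∧ σ a ≠ σ (σ a) := by
    simpa [and_assoc] using hnodup
  have hG : HasThreeCycle G (a : D) (σ a) (σ (σ a)) :=
    hasThreeCycle_of_threeCycleSetoid (hC _ a.2 _ (σ a).2) (hC _ (σ a).2 _ (σ (σ a)).2)
      (Subtype.coe_ne_coe.2 hab) (Subtype.coe_ne_coe.2 hbc) (Subtype.coe_ne_coe.2 hac)
  refine ⟨_, hG.2.2.2, fun x => ?_⟩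
  rw [Perm.mul_apply, Subtype.coe_injective.swap_apply, Subtype.coe_injective.swap_apply,
    ← Perm.mul_apply, ← hσ_eq]

theorem exists_transversal_card_le_mul {α : Type*} [Fintype α] (r : Setoid α) {m : ℕ}
    (hm : ∀ a, {x | r x a}.ncard ≤ m) :
    ∃ T : Finset α, (∀ a ∈ T, ∀ b ∈ T, r a b → a = b) ∧ Fintype.card α ≤ m * #T := by
  classical
  let rep : α → α := fun x => (⟦x⟧ : Quotient r).out
  have hrep : ∀ x, r (rep x) x := fun x => Quotient.mk_out x
  refine ⟨Finset.univ.image rep, ?_, Finset.card_le_mul_card_image _ _ fun a _ => ?_⟩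
  · simp only [Finset.mem_image, Finset.mem_univ, true_and, forall_exists_index,
      forall_apply_eq_imp_iff]
    intro x y hxy
    exact congrArg Quotient.out
      (Quotient.sound (r.trans (r.symm (hrep x)) (r.trans hxy (hrep y))))
  · rw [← Set.ncard_coe_finset]
    refine (Set.ncard_le_ncard fun x hx => ?_).trans (hm a)
    obtain rfl : rep x = a := by simpa using hx
    exact r.symm (hrep x)

theorem exists_perm_map_eq {D : Type*} [Finite D] {y : D} {C C' : Finset D} (hy : y ∈ C)
    (hy' : y ∈ C') (hcard : #C = #C') : ∃ g : Perm D, g y = y ∧ ∀ x, g x ∈ C' ↔ x ∈ C := by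
  classical
  let e : {x // x ∈ C} ≃ {x // x ∈ C'} := Finset.equivOfCardEq hcard
  let σ : Perm D := e.extendSubtype
  have hσ : ∀ x, σ x ∈ C' ↔ x ∈ C := fun x =>
    ⟨fun h => by_contra fun hx => e.extendSubtype_not_mem x hx h, e.extendSubtype_mem x⟩
  refine ⟨swap (σ y) y * σ, by simp, fun x => ?_⟩
  have hσy : σ y ∈ C' := (hσ y).2 hy
  rw [← hσ x, Perm.mul_apply]
  grind

section Index

variable {D : Type*} [Fintype D] {G : Subgroup (Perm D)}

theorem index_le_pow {k : ℕ} (hk : k ≤ Fintype.card D)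
    (hG : (Fintype.card D - k)! ≤ Nat.card G) : G.index ≤ Fintype.card D ^ k := by
  classical
  refine Nat.le_of_mul_le_mul_left ?_ (Nat.card_pos (α := G))
  calc Nat.card G * G.index = (Fintype.card D)! := by
        rw [G.card_mul_index, Nat.card_perm, Nat.card_eq_fintype_card]
    _ = (Fintype.card D - k)! * (Fintype.card D).descFactorial k :=
        (Nat.factorial_mul_descFactorial hk).symm
    _ ≤ Nat.card G * Fintype.card D ^ k := Nat.mul_le_mul hG (Nat.descFactorial_le_pow _ _)

theorem factorial_card_le_index [DecidableEq D] {W : Finset D}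
    (hW : ∀ g ∈ G, g.support ⊆ W → g = 1) : (#W)! ≤ G.index := by
  let H : Subgroup (Perm D) := (Perm.ofSubtype (p := (· ∈ W))).range
  have hGH : G ⊓ H = ⊥ := by
    rw [eq_bot_iff]
    rintro _ ⟨hg, σ, rfl⟩
    refine hW _ hg fun x hx => ?_
    by_contra hxW
    exact Perm.mem_support.1 hx (Perm.ofSubtype_apply_of_not_mem σ hxW)
  calc (#W)! = Nat.card H := by
        rw [← Nat.card_congr (MonoidHom.ofInjective Perm.ofSubtype_injective).toEquiv,
          Nat.card_perm, Nat.card_eq_fintype_card, Fintype.card_coe]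
    _ = G.relIndex H := by rw [← Subgroup.inf_relIndex_right, hGH, Subgroup.relIndex_bot_left]
    _ ≤ G.relIndex ⊤ := Subgroup.relIndex_le_of_le_right le_top
        (by rw [Subgroup.relIndex_top_right]; exact Subgroup.index_ne_zero_of_finite)
    _ = G.index := G.relIndex_top_right

theorem choose_le_index {y : D} {C : Finset D} (hy : y ∈ C)
    (hC : ∀ g ∈ G, g y = y → ∀ x ∈ C, g x ∈ C) :
    (Fintype.card D - 1).choose (#C - 1) ≤ G.index := by
  classical
  let P : Finset (Finset D) := (Finset.univ.erase y).powersetCard (#C - 1)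
  have hyP : ∀ S ∈ P, y ∉ S := fun S hS h =>
    Finset.notMem_erase y _ ((Finset.mem_powersetCard.1 hS).1 h)
  have hex : ∀ S ∈ P, ∃ g : Perm D, g y = y ∧ ∀ x, g x ∈ insert y S ↔ x ∈ C := by
    intro S hS
    refine exists_perm_map_eq hy (Finset.mem_insert_self y S) ?_
    rw [Finset.card_insert_of_notMem (hyP S hS), (Finset.mem_powersetCard.1 hS).2,
      Nat.sub_add_cancel (Finset.card_pos.2 ⟨y, hy⟩)]
  choose! f hfy hf using hex
  have hsub : ∀ S ∈ P, ∀ S' ∈ P, (f S : Perm D ⧸ G) = f S' → S' ⊆ S := by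
    intro S hS S' hS' heq x hx
    obtain ⟨z, rfl⟩ := (f S').surjective x
    have hz : z ∈ C := (hf S' hS' z).1 (Finset.mem_insert_of_mem hx)
    have hfix : ((f S)⁻¹ * f S') y = y := by
      rw [Perm.mul_apply, hfy S' hS', Perm.inv_eq_iff_eq, hfy S hS]
    have hmem : f S' z ∈ insert y S := by
      simpa using (hf S hS _).2 (hC _ (QuotientGroup.eq.1 heq) hfix z hz)
    exact Finset.mem_of_mem_insert_of_ne hmem fun h => hyP S' hS' (h ▸ hx)
  calc (Fintype.card D - 1).choose (#C - 1) = Nat.card P := by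
        rw [Nat.card_eq_fintype_card, Fintype.card_coe, Finset.card_powersetCard,
          Finset.card_erase_of_mem (Finset.mem_univ y), Finset.card_univ]
    _ ≤ Nat.card (Perm D ⧸ G) :=
        Nat.card_le_card_of_injective (fun S : P => (f S : Perm D ⧸ G)) fun S S' heq =>
          Subtype.ext ((hsub _ S'.2 _ S.2 heq.symm).antisymm (hsub _ S.2 _ S'.2 heq))

end Index

theorem eventually_mul_pow_lt_choose (c k : ℕ) :
    ∀ᶠ n in atTop, c * n ^ k < n.choose (k + 1) := by
  have h : (fun n : ℕ => (c : ℝ) * (n : ℝ) ^ k) =o[atTop] fun n => (n.choose (k + 1) : ℝ) :=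
    (((isLittleO_pow_pow_atTop_of_lt k.lt_succ_self).comp_tendsto
      tendsto_natCast_atTop_atTop).const_mul_left _).trans_isTheta (isTheta_choose (k + 1)).symm
  filter_upwards [h.bound one_half_pos, eventually_ge_atTop (k + 1)] with n hn hk
  have hpos : (0 : ℝ) < n.choose (k + 1) := mod_cast Nat.choose_pos hk
  rw [Real.norm_of_nonneg (by positivity), Real.norm_of_nonneg (by positivity)] at hn
  have : (c * n ^ k : ℝ) < n.choose (k + 1) := hn.trans_lt (by linarith)
  exact_mod_cast this

theorem choose_le_choose_of_le_of_add_le {m r j : ℕ} (hrj : r ≤ j) (hj : j + r ≤ m) :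
    m.choose r ≤ m.choose j := by
  refine Nat.le_of_mul_le_mul_right ?_ (Nat.choose_pos hrj)
  calc m.choose r * j.choose r = m.choose r * j.choose (j - r) := by rw [Nat.choose_symm hrj]
    _ ≤ m.choose r * (m - r).choose (j - r) := by
        gcongr
        omega
    _ = m.choose j * j.choose r := (Nat.choose_mul hrj).symm

theorem eventually_forall_pow_lt_factorial (m k : ℕ) :
    ∀ᶠ n in atTop, ∀ w : ℕ, n ≤ m * (2 * w) → n ^ k < w ! := by
  obtain ⟨w₀, hw₀⟩ := eventually_atTop.1 ((eventually_mul_pow_lt_choose ((m * 2) ^ k) k).and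
    (eventually_ge_atTop (k + 1)))
  filter_upwards [eventually_gt_atTop (m * (2 * w₀))] with n hn w hnw
  have hw : w₀ ≤ w := by
    by_contra! hlt
    have : m * (2 * w) ≤ m * (2 * w₀) := by gcongr
    omega
  calc n ^ k ≤ (m * (2 * w)) ^ k := Nat.pow_le_pow_left hnw k
    _ = (m * 2) ^ k * w ^ k := by rw [← mul_assoc, mul_pow]
    _ < w.choose (k + 1) := (hw₀ w hw).1
    _ ≤ w.descFactorial (k + 1) := Nat.choose_le_descFactorial _ _
    _ ≤ (w - (k + 1))! * w.descFactorial (k + 1) :=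
        Nat.le_mul_of_pos_left _ (Nat.factorial_pos _)
    _ = w ! := Nat.factorial_mul_descFactorial (hw₀ w hw).2

theorem eventually_pow_lt_choose_pred (k : ℕ) :
    ∀ᶠ n in atTop, n ^ k < (n - 1).choose (k + 1) := by
  filter_upwards [(tendsto_sub_atTop_nat 1).eventually (eventually_mul_pow_lt_choose (2 ^ k) k),
    eventually_ge_atTop 2] with n hn h2
  calc n ^ k ≤ (2 * (n - 1)) ^ k := Nat.pow_le_pow_left (by omega) k
    _ = 2 ^ k * (n - 1) ^ k := mul_pow _ _ _
    _ < (n - 1).choose (k + 1) := hn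

section Classes

variable {D : Type*} [Fintype D] [DecidableEq D] {G : Subgroup (Perm D)}

theorem exists_card_le_two_mul_of_forall_not_hasThreeCycle {T : Finset D}
    (hT : ∀ a ∈ T, ∀ b ∈ T, ∀ c ∈ T, ¬ HasThreeCycle G a b c) :
    ∃ W : Finset D, #T ≤ 2 * #W ∧ ∀ g ∈ G, g.support ⊆ W → g = 1 := by
  obtain ⟨W, ⟨hWT, hW⟩, hmax⟩ : ∃ W, Maximal
      (fun W : Finset D => W ⊆ T ∧ ∀ g ∈ G, g.support ⊆ W → g = 1) W :=
    (Set.toFinite _).exists_maximal ⟨∅, Finset.empty_subset T,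
      fun _ _ hg => Perm.support_eq_empty_iff.1 (Finset.subset_empty.1 hg)⟩
  by_cases hcard : #T ≤ 2 * #W
  · exact ⟨W, hcard, hW⟩
  refine ⟨T \ W, by rw [Finset.card_sdiff_of_subset hWT]; omega, fun x hx hxs => ?_⟩
  by_contra hx1
  obtain ⟨a, ha⟩ : x.support.Nonempty := Finset.nonempty_iff_ne_empty.2 (by simpa using hx1)
  obtain ⟨haT, haW⟩ := Finset.mem_sdiff.1 (hxs ha)
  -- By maximality of `W` some nontrivial `y ∈ G` lives on `W ∪ {a}`, and it must move `a`.
  obtain ⟨y, hy, hys, hy1⟩ : ∃ y ∈ G, y.support ⊆ insert a W ∧ y ≠ 1 := by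
    by_contra! hcon
    exact haW (hmax ⟨Finset.insert_subset haT hWT, hcon⟩ (Finset.subset_insert a W)
      (Finset.mem_insert_self a W))
  have hya : a ∈ y.support := by
    by_contra hya
    exact hy1 (hW y hy ((Finset.subset_insert_iff_of_notMem hya).1 hys))
  have hinter : ∀ d ≠ a, x d = d ∨ y d = d := by
    intro d hda
    by_contra! hd
    have hdW := Finset.mem_of_mem_insert_of_ne (hys (Perm.mem_support.2 hd.2)) hda
    exact (Finset.mem_sdiff.1 (hxs (Perm.mem_support.2 hd.1))).2 hdW
  exact hT a haT (x a) (Finset.mem_sdiff.1 (hxs (Perm.apply_mem_support.2 ha))).1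
    (y a) (Finset.insert_subset haT hWT (hys (Perm.apply_mem_support.2 hya)))
    (hasThreeCycle_of_support_inter hx hy (Perm.mem_support.1 ha) (Perm.mem_support.1 hya) hinter)

/-- The equivalence class of `y` under `threeCycleSetoid G`. -/
noncomputable def threeCycleClass (G : Subgroup (Perm D)) (y : D) : Finset D :=
  {x | threeCycleSetoid G x y}.toFinite.toFinset

theorem mem_threeCycleClass {x y : D} : x ∈ threeCycleClass G y ↔ threeCycleSetoid G x y := by
  simp [threeCycleClass]

theorem map_mem_threeCycleClass {g : Perm D} (hg : g ∈ G) {y z : D}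
    (hz : z ∈ threeCycleClass G y) (hgz : g z ∈ threeCycleClass G y) {x : D}
    (hx : x ∈ threeCycleClass G y) : g x ∈ threeCycleClass G y := by
  rw [mem_threeCycleClass] at *
  have hxz := (threeCycleSetoid G).trans hx ((threeCycleSetoid G).symm hz)
  exact (threeCycleSetoid G).trans (threeCycleSetoid_map hxz hg) hgz

theorem isFixedSet_threeCycleClass {y : D}
    (hy : Fintype.card D < 2 * #(threeCycleClass G y)) : IsFixedSet G (threeCycleClass G y) := by
  intro g hg x hx
  have hcard : #(Finset.univ : Finset D) <
      #((threeCycleClass G y).map g.toEmbedding) + #(threeCycleClass G y) := by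
    rw [Finset.card_map, Finset.card_univ]
    omega
  obtain ⟨z', hz'⟩ := Finset.inter_nonempty_of_card_lt_card_add_card
    (Finset.subset_univ _) (Finset.subset_univ _) hcard
  obtain ⟨hz₁, hz₂⟩ := Finset.mem_inter.1 hz'
  obtain ⟨z, hz, rfl⟩ := Finset.mem_map.1 hz₁
  exact map_mem_threeCycleClass hg hz hz₂ hx

theorem alternatingGroup_threeCycleClass_le (y : D) :
    alternatingGroup (threeCycleClass G y) ≤ inducedGroup G (threeCycleClass G y) :=
  alternatingGroup_le_inducedGroup fun _ ha _ hb => (threeCycleSetoid G).trans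
    (mem_threeCycleClass.1 ha) ((threeCycleSetoid G).symm (mem_threeCycleClass.1 hb))

theorem choose_card_threeCycleClass_le_index (y : D) :
    (Fintype.card D - 1).choose (#(threeCycleClass G y) - 1) ≤ G.index := by
  have hy : y ∈ threeCycleClass G y := mem_threeCycleClass.2 ((threeCycleSetoid G).refl y)
  exact choose_le_index hy fun g hg hgy x hx =>
    map_mem_threeCycleClass hg hy (hgy.symm ▸ hy) hx

theorem exists_factorial_le_index {m : ℕ} (hm : ∀ y, #(threeCycleClass G y) ≤ m) :
    ∃ w, Fintype.card D ≤ m * (2 * w) ∧ w ! ≤ G.index := by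
  obtain ⟨T, hT, hcard⟩ := exists_transversal_card_le_mul (threeCycleSetoid G) (m := m)
    fun y => (Set.ncard_eq_toFinset_card _ _).trans_le (hm y)
  obtain ⟨W, hTW, hW⟩ := exists_card_le_two_mul_of_forall_not_hasThreeCycle (G := G) (T := T)
    fun a ha b hb c _ habc => habc.1 (hT a ha b hb (Or.inr ⟨c, habc⟩))
  exact ⟨#W, hcard.trans (Nat.mul_le_mul_left m hTW), factorial_card_le_index hW⟩

end Classes

theorem lemma7p7 (k : ℕ) :
    ∃ N : ℕ, k ≤ N ∧
      ∀ (D : Type*) [Fintype D] [DecidableEq D] (G : Subgroup (Equiv.Perm D)),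
        N ≤ Fintype.card D →
        (Fintype.card D - k).factorial ≤ Nat.card G →
        ∃ Δ : Finset D, IsFixedSet G Δ ∧ Fintype.card D - k ≤ Δ.card ∧
          alternatingGroup Δ ≤ inducedGroup G Δ := by
  obtain ⟨N, hN⟩ := eventually_atTop.1 ((eventually_forall_pow_lt_factorial (k + 1) k).and
    ((eventually_pow_lt_choose_pred k).and (eventually_gt_atTop (2 * k))))
  refine ⟨N, by have := (hN N le_rfl).2.2; omega, fun D _ _ G hD hG => ?_⟩
  obtain ⟨hfactorial, hchoose, hk⟩ := hN _ hD
  have hindex : G.index ≤ Fintype.card D ^ k := index_le_pow (by omega) hG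
  obtain ⟨y, hy⟩ : ∃ y, k + 1 < #(threeCycleClass G y) := by
    by_contra! hsmall
    obtain ⟨w, hw, hw_index⟩ := exists_factorial_le_index hsmall
    exact (hfactorial w hw).not_ge (hw_index.trans hindex)
  have hlarge : Fintype.card D - k ≤ #(threeCycleClass G y) := by
    by_contra! hlt
    have hmono := choose_le_choose_of_le_of_add_le (m := Fintype.card D - 1) (r := k + 1)
      (j := #(threeCycleClass G y) - 1) (by omega) (by omega)
    exact (hchoose.trans_le hmono).not_ge
      ((choose_card_threeCycleClass_le_index y).trans hindex)
  exact ⟨threeCycleClass G y, isFixedSet_threeCycleClass (by omega), hlarge,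
    alternatingGroup_threeCycleClass_le y⟩
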